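/- Let $k \ge 0$ be an integer and let $\mathrm{IP} : \{0,1\}^{2k} \to \{0,1\}$ be the negated inner product function on $k$ pairs of variables: $\mathrm{IP}(x_1,\dots,x_k,y_1,\dots,y_k) = 1$ if $\sum_{i=1}^k x_i y_i \equiv 0 \pmod 2$, and $\mathrm{IP}(x_1,\dots,x_k,y_1,\dots,y_k) = 0$ otherwise. A 2-CNF formula is a conjunction of finitely many clauses, each of which is a disjunction of at most two literals. A 2-CNF formula $\varphi$ in the variables $x_1,\dots,x_k,y_1,\dots,y_k$ is consistent with $\mathrm{IP}$ if every assignment that satisfies $\varphi$ is mapped to $1$ by $\mathrm{IP}$. Then every 2-CNF formula $\varphi$ consistent with $\mathrm{IP}$ has at most $3^k$ satisfying assignments among the $2^{2k}$ assignments to these variables. This bound is tight: for every $k$ there is a 2-CNF formula consistent with $\mathrm{IP}$ that has exactly $3^k$ satisfying assignments. -/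

import Mathlib

open Std.Sat

/-- The variables of the inner product on `k` pairs: `Sum.inl i` is `x i`, `Sum.inr i` is `y i`. -/
abbrev IPVar (k : ℕ) : Type := Fin k ⊕ Fin k

/-- The (negated) inner product function: it is `true` exactly when
`∑ i, x i * y i` is congruent to `0` modulo `2`. -/
def innerProd {k : ℕ} (a : IPVar k → Bool) : Bool :=
  decide ((∑ i : Fin k, (a (Sum.inl i)).toNat * (a (Sum.inr i)).toNat) % 2 = 0)

/-- A CNF formula has width at most `w` if each of its clauses has at most `w` distinct literals,
that is, it is a `w`-CNF formula. -/
def IsKCNF {α : Type*} [DecidableEq α] (w : ℕ) (φ : CNF α) : Prop :=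
  ∀ c ∈ φ.clauses, (List.toFinset c).card ≤ w

/-- The set of satisfying assignments of a CNF formula. -/
def satSet {α : Type*} [Fintype α] [DecidableEq α] (φ : CNF α) : Finset (α → Bool) :=
  Finset.univ.filter fun a => φ.eval a = true

/-- A CNF formula is consistent with the inner product if each of its satisfying assignments
is mapped to `1` by the (negated) inner product function. -/
def ConsistentWithIP {k : ℕ} (φ : CNF (IPVar k)) : Prop :=
  ∀ a ∈ satSet φ, innerProd a = true

/-! The solutions of a 2-CNF form a majority-closed set, and a set of assignments has at most as
many elements as it shatters subsets of variables (Pajor). Join two variables when the pair is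
shattered: every shattered set is a clique, and by the Helly property cliques with at least two
vertices are shattered. A shattered set `I` has at most `k` elements: a minimal majority-closed
subset shattering `I` is affine, and an affine space on which the quadratic form `∑ x i * y i`
vanishes has dimension at most `k`. So the graph is `K_{k+1}`-free on `2k` vertices and has at most
`3 ^ k` cliques. Disjointness attains the bound. -/

/-! ### Majority-closed sets and shattering -/

/-- A set of Boolean assignments closed under the coordinatewise majority of three. -/
def MajClosed {V : Type*} (S : Set (V → Bool)) : Prop :=
  ∀ a ∈ S, ∀ b ∈ S, ∀ c ∈ S, (fun v => (a v && b v) || (b v && c v) || (a v && c v)) ∈ S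

/-- Every Boolean assignment to `I` is the restriction of an element of `S`. -/
def ShattersOn {V : Type*} (S : Set (V → Bool)) (I : Finset V) : Prop :=
  ∀ t : V → Bool, ∃ s ∈ S, ∀ i ∈ I, s i = t i

theorem MajClosed.inter_coord {V : Type*} {S : Set (V → Bool)} (hS : MajClosed S) (z : V)
    (b : Bool) : MajClosed {s ∈ S | s z = b} := by
  rintro p ⟨hp, hpz⟩ q ⟨hq, hqz⟩ r ⟨hr, hrz⟩
  refine ⟨hS p hp q hq r hr, ?_⟩
  simp [hpz, hqz, hrz]

/-- The Helly property of majority-closed sets (Baker–Pixley). -/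
theorem MajClosed.exists_agree {V : Type*} [DecidableEq V] {S : Set (V → Bool)}
    (hS : MajClosed S) (hne : S.Nonempty) (t : V → Bool) (I : Finset V)
    (h : ∀ i ∈ I, ∀ j ∈ I, ∃ s ∈ S, s i = t i ∧ s j = t j) :
    ∃ s ∈ S, ∀ i ∈ I, s i = t i := by
  induction I using Finset.strongInduction with
  | H I ih =>
    by_cases hI : 2 < I.card
    · obtain ⟨x, y, z, hx, hy, hz, hxy, hxz, hyz⟩ := Finset.two_lt_card_iff.1 hI
      have aux : ∀ w ∈ I, ∃ s ∈ S, ∀ i ∈ I, i ≠ w → s i = t i := by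
        intro w hw
        obtain ⟨s, hs, hst⟩ := ih (I.erase w) (Finset.erase_ssubset hw) fun i hi j hj =>
          h i (Finset.mem_of_mem_erase hi) j (Finset.mem_of_mem_erase hj)
        exact ⟨s, hs, fun i hi hiw => hst i (Finset.mem_erase.2 ⟨hiw, hi⟩)⟩
      obtain ⟨p, hp, hpt⟩ := aux x hx
      obtain ⟨q, hq, hqt⟩ := aux y hy
      obtain ⟨r, hr, hrt⟩ := aux z hz
      -- At each coordinate of `I` at most one of `p`, `q`, `r` can differ from `t`, so the majority
      -- agrees with `t`.
      refine ⟨_, hS p hp q hq r hr, fun i hi => ?_⟩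
      have hpi := hpt i hi
      have hqi := hqt i hi
      have hri := hrt i hi
      by_cases h1 : i = x
      · rw [hqi (by grind), hri (by grind)]; cases t i <;> simp
      · by_cases h2 : i = y
        · rw [hpi h1, hri (by grind)]; cases t i <;> simp
        · rw [hpi h1, hqi h2]; cases t i <;> simp
    · rcases I.eq_empty_or_nonempty with rfl | ⟨i, hi⟩
      · obtain ⟨s, hs⟩ := hne
        exact ⟨s, hs, by simp⟩
      · by_cases hj : ∃ j ∈ I, j ≠ i
        · obtain ⟨j, hj, hij⟩ := hj
          obtain ⟨s, hs, h1, h2⟩ := h i hi j hj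
          refine ⟨s, hs, fun l hl => ?_⟩
          by_contra hne'
          exact hI (Finset.two_lt_card_iff.2 ⟨i, j, l, hi, hj, hl, hij.symm,
            fun e => hne' (e ▸ h1), fun e => hne' (e ▸ h2)⟩)
        · push Not at hj
          obtain ⟨s, hs, h1, -⟩ := h i hi i hi
          exact ⟨s, hs, fun l hl => by rw [hj l hl, h1]⟩

/-- In a majority-closed set shattering `I`, each coordinate can be fixed to a constant while
keeping `I` shattered, or is a literal of a variable in `I`. -/
theorem MajClosed.shattersOn_coord_or_literal {V : Type*} [DecidableEq V] {S : Set (V → Bool)}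
    (hS : MajClosed S) {I : Finset V} (hI : ShattersOn S I) (z : V) :
    (∃ b, ShattersOn {s ∈ S | s z = b} I) ∨
      ∃ i ∈ I, ∃ b, ∀ s ∈ S, s z = (s i ^^ b) := by
  by_cases hc : ∃ b, ∀ s ∈ S, s z = b
  · obtain ⟨b, hb⟩ := hc
    refine Or.inl ⟨b, fun t => ?_⟩
    obtain ⟨s, hs, hst⟩ := hI t
    exact ⟨s, ⟨hs, hb s hs⟩, hst⟩
  push Not at hc
  by_cases hz : z ∈ I
  · exact Or.inr ⟨z, hz, false, by simp⟩
  rw [or_iff_not_imp_left]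
  intro hn
  push Not at hn
  -- Otherwise each literal on `I` is compatible with `z = b`, and the Helly property on `insert z
  -- I` keeps `I` shattered after fixing `z = b`.
  have key : ∀ b, ∃ i ∈ I, ∃ α, ∀ s ∈ S, s i = α → s z = !b := by
    intro b
    by_contra hcon
    push Not at hcon
    refine hn b fun t => ?_
    obtain ⟨w, hw, hwz⟩ := hc (!b)
    have hne : ∀ i ∈ I, i ≠ z := fun i hi e => hz (e ▸ hi)
    obtain ⟨s, hs, hst⟩ := hS.exists_agree ⟨w, hw⟩ (Function.update t z b) (insert z I) (by
      intro i hi j hj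
      rcases Finset.mem_insert.1 hi with hiz | hi' <;>
        rcases Finset.mem_insert.1 hj with hjz | hj'
      · exact ⟨w, hw, by simpa [hiz] using hwz, by simpa [hjz] using hwz⟩
      · obtain ⟨s, hs, h1, h2⟩ := hcon j hj' (t j)
        exact ⟨s, hs, by simpa [hiz] using h2, by simpa [hne j hj'] using h1⟩
      · obtain ⟨s, hs, h1, h2⟩ := hcon i hi' (t i)
        exact ⟨s, hs, by simpa [hne i hi'] using h1, by simpa [hjz] using h2⟩
      · obtain ⟨s, hs, h⟩ := hI t
        exact ⟨s, hs, by simpa [hne i hi'] using h i hi', by simpa [hne j hj'] using h j hj'⟩)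
    refine ⟨s, ⟨hs, by simpa using hst z (Finset.mem_insert_self _ _)⟩, fun i hi => ?_⟩
    simpa [hne i hi] using hst i (Finset.mem_insert_of_mem hi)
  obtain ⟨i, hi, α, hα⟩ := key true
  obtain ⟨j, hj, β, hβ⟩ := key false
  -- Unless the two forcing literals are complementary, shattering satisfies both at once and `z`
  -- takes two values.
  have hij : i = j ∧ α = !β := by
    by_contra hne
    obtain ⟨s, hs, hst⟩ := hI (fun v => if v = i then α else β)
    have h1 := hα s hs (by simpa using hst i hi)
    have h2 := hβ s hs (by
      rw [hst j hj]
      split_ifs with h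
      · subst h
        cases α <;> cases β <;> simp_all
      · rfl)
    simp [h1] at h2
  obtain ⟨rfl, rfl⟩ := hij
  refine ⟨i, hi, !β, fun s hs => ?_⟩
  have h1 := hα s hs
  have h2 := hβ s hs
  cases h : s i <;> cases h' : s z <;> cases β <;> simp_all

/-- A majority-closed set shattering `I` contains an affine subset shattering `I`. -/
theorem MajClosed.exists_affine_subset {V : Type*} [DecidableEq V] [Finite V]
    {S : Set (V → Bool)} (hS : MajClosed S) {I : Finset V} (hI : ShattersOn S I) :
    ∃ T ⊆ S, ShattersOn T I ∧
      ∀ a ∈ T, ∀ b ∈ T, ∀ c ∈ T, (fun v => (a v ^^ b v ^^ c v)) ∈ T := by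
  -- By minimality a coordinate that can be fixed is already constant on `T`, so every coordinate is
  -- an affine function of at most one variable in `I`.
  obtain ⟨T, hT⟩ := (Set.toFinite {T : Set (V → Bool) | T ⊆ S ∧ MajClosed T ∧ ShattersOn T I}).exists_minimal
    ⟨S, subset_rfl, hS, hI⟩
  obtain ⟨hTS, hTm, hTI⟩ := hT.prop
  refine ⟨T, hTS, hTI, fun a ha b hb c hc => ?_⟩
  obtain ⟨d, hd, hdI⟩ := hTI fun v => (a v ^^ b v ^^ c v)
  convert hd using 1
  ext1 z
  rcases hTm.shattersOn_coord_or_literal hTI z with ⟨e, he⟩ | ⟨i, hi, e, he⟩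
  · have hz : ∀ s ∈ T, s z = e := fun s hs =>
      (hT.le_of_le (y := {s ∈ T | s z = e})
        ⟨(Set.sep_subset _ _).trans hTS, hTm.inter_coord z e, he⟩ (Set.sep_subset _ _) hs).2
    rw [hz a ha, hz b hb, hz c hc, hz d hd]
    simp
  · rw [he a ha, he b hb, he c hc, he d hd, hdI i hi]
    cases a i <;> cases b i <;> cases c i <;> cases e <;> rfl

/-! ### Isotropic subspaces over `ZMod 2` -/

/-- The polar form of the quadratic form `∑ i, x i * y i` over `ZMod 2`. -/
def ipPolar (k : ℕ) : LinearMap.BilinForm (ZMod 2) (IPVar k → ZMod 2) :=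
  LinearMap.mk₂ (ZMod 2)
    (fun v w => ∑ i, (v (Sum.inl i) * w (Sum.inr i) + v (Sum.inr i) * w (Sum.inl i)))
    (fun _ _ _ => by
      rw [← Finset.sum_add_distrib]; exact Finset.sum_congr rfl fun _ _ => by simp; ring)
    (fun _ _ _ => by
      rw [Finset.smul_sum]; exact Finset.sum_congr rfl fun _ _ => by simp; ring)
    (fun _ _ _ => by
      rw [← Finset.sum_add_distrib]; exact Finset.sum_congr rfl fun _ _ => by simp; ring)
    (fun _ _ _ => by
      rw [Finset.smul_sum]; exact Finset.sum_congr rfl fun _ _ => by simp; ring)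

theorem ipPolar_apply {k : ℕ} (v w : IPVar k → ZMod 2) : ipPolar k v w =
    ∑ i, (v (Sum.inl i) * w (Sum.inr i) + v (Sum.inr i) * w (Sum.inl i)) := rfl

theorem ipPolar_comm {k : ℕ} (v w : IPVar k → ZMod 2) : ipPolar k v w = ipPolar k w v := by
  simp only [ipPolar_apply]
  exact Finset.sum_congr rfl fun _ _ => by ring

theorem ipPolar_nondegenerate (k : ℕ) : (ipPolar k).Nondegenerate := by
  have hl : (ipPolar k).SeparatingLeft := by
    intro v hv
    ext j
    rcases j with j | j
    · simpa [ipPolar_apply, Pi.single_apply] using hv (Pi.single (Sum.inr j) 1)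
    · simpa [ipPolar_apply, Pi.single_apply] using hv (Pi.single (Sum.inl j) 1)
  exact ⟨hl, fun v hv => hl v fun w => by rw [ipPolar_comm]; exact hv w⟩

/-- A translate of a subspace on which `∑ i, x i * y i` vanishes has dimension at most `k`. -/
theorem finrank_le_of_ip_vanish {k : ℕ} (W : Submodule (ZMod 2) (IPVar k → ZMod 2))
    (a : IPVar k → ZMod 2)
    (h : ∀ w ∈ W, ∑ i, (a + w) (Sum.inl i) * (a + w) (Sum.inr i) = 0) :
    Module.finrank (ZMod 2) W ≤ k := by
  -- Polarization makes `W` totally isotropic, whence `dim W ≤ 2k - dim W`.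
  have hle : W ≤ (ipPolar k).orthogonal W := by
    intro v hv w hw
    have h0 := h 0 W.zero_mem
    have h1 := h v hv
    have h2 := h w hw
    have h3 := h (v + w) (W.add_mem hv hw)
    have : ipPolar k w v = ∑ i, (a + (v + w)) (Sum.inl i) * (a + (v + w)) (Sum.inr i)
        - ∑ i, (a + v) (Sum.inl i) * (a + v) (Sum.inr i)
        - ∑ i, (a + w) (Sum.inl i) * (a + w) (Sum.inr i)
        + ∑ i, (a + 0) (Sum.inl i) * (a + 0) (Sum.inr i) := by
      rw [ipPolar_apply, ← Finset.sum_sub_distrib, ← Finset.sum_sub_distrib,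
        ← Finset.sum_add_distrib]
      exact Finset.sum_congr rfl fun _ _ => by simp only [Pi.add_apply, Pi.zero_apply]; ring
    change ipPolar k w v = 0
    rw [this, h0, h1, h2, h3]
    simp
  have h1 := Submodule.finrank_mono hle
  rw [LinearMap.BilinForm.finrank_orthogonal (ipPolar_nondegenerate k),
    Module.finrank_fintype_fun_eq_card] at h1
  simp only [Fintype.card_sum, Fintype.card_fin] at h1
  omega

theorem innerProd_eq_true_iff {k : ℕ} (a : IPVar k → Bool) : innerProd a = true ↔
    ∑ i, ((a (Sum.inl i)).toNat : ZMod 2) * ((a (Sum.inr i)).toNat : ZMod 2) = 0 := by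
  rw [innerProd, decide_eq_true_iff, ← Nat.dvd_iff_mod_eq_zero, ← CharP.cast_eq_zero_iff (ZMod 2) 2]
  push_cast
  rfl

/-! ### Counting cliques -/

/-- A `K_{k+1}`-free graph on `2k` vertices has at most `3 ^ k` cliques. -/
theorem SimpleGraph.CliqueFree.card_cliques_le {V : Type*} [Fintype V] [DecidableEq V]
    {G : SimpleGraph V} {k : ℕ} (hV : Fintype.card V = 2 * k) (hG : G.CliqueFree (k + 1))
    (F : Finset (Finset V)) (hF : ∀ s ∈ F, G.IsClique (s : Set V)) : F.card ≤ 3 ^ k := by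
  classical
  obtain ⟨H, hGH, hH⟩ := (Set.toFinite {H : SimpleGraph V | H.CliqueFree (k + 1)}).exists_le_maximal hG
  -- Without a `k`-clique, adding any edge would create no `(k + 1)`-clique, so maximality would
  -- make `H` complete.
  have hHk : ¬ H.CliqueFree k := by
    intro hfree
    have htop : H = ⊤ := by
      ext u v
      refine ⟨fun h => h.ne, fun huv => ?_⟩
      refine hH.le_of_ge (hfree.sup_edge u v) le_sup_left ?_
      simp [SimpleGraph.edge_adj, SimpleGraph.sup_adj]
      exact Or.inr huv
    obtain ⟨K, -, hK⟩ := Finset.exists_subset_card_eq (s := (Finset.univ : Finset V)) (n := k)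
      (by rw [Finset.card_univ]; omega)
    exact hfree K ⟨by rw [htop]; intro a _ b _ hab; exact hab, hK⟩
  obtain ⟨K, hKc, hK⟩ := not_forall_not.1 hHk
  have hcard : Kᶜ.card = k := by rw [Finset.card_compl, hV, hK]; omega
  have hfiber : ∀ C ∈ Kᶜ.powerset, (F.filter fun s => s \ K = C).card ≤ 1 ^ C.card * 2 ^ (k - C.card) := by
    intro C hC
    rw [one_pow, one_mul]
    rcases (F.filter fun s => s \ K = C).eq_empty_or_nonempty with he | ⟨s, hs⟩
    · simp [he]
    obtain ⟨hsF, rfl⟩ := Finset.mem_filter.1 hs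
    -- A clique with the same part outside `K` meets `K` inside these common neighbours, which
    -- extend that part to a clique of `H`.
    set N := K.filter fun v => ∀ c ∈ s \ K, H.Adj v c with hN
    have hclique : H.IsClique ((s \ K ∪ N : Finset V) : Set V) := by
      intro a ha b hb hab
      rw [Finset.mem_coe, Finset.mem_union] at ha hb
      rcases ha with ha | ha <;> rcases hb with hb | hb
      · exact hGH (hF s hsF (Finset.mem_sdiff.1 ha).1 (Finset.mem_sdiff.1 hb).1 hab)
      · exact ((Finset.mem_filter.1 hb).2 a ha).symm
      · exact (Finset.mem_filter.1 ha).2 b hb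
      · exact hKc (Finset.mem_filter.1 ha).1 (Finset.mem_filter.1 hb).1 hab
    have hdisj : Disjoint (s \ K) N :=
      Finset.disjoint_of_subset_right (Finset.filter_subset _ _) Finset.sdiff_disjoint
    have hNcard : N.card ≤ k - (s \ K).card := by
      have h1 : (s \ K ∪ N).card < k + 1 := by
        by_contra hlt
        exact (hH.prop.mono (not_lt.1 hlt)) _ ⟨hclique, rfl⟩
      rw [Finset.card_union_of_disjoint hdisj] at h1
      omega
    calc (F.filter fun r => r \ K = s \ K).card ≤ N.powerset.card := by
          refine Finset.card_le_card_of_injOn (fun r => r ∩ K) ?_ ?_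
          · intro r hr
            obtain ⟨hrF, hrs⟩ := Finset.mem_filter.1 hr
            refine Finset.mem_coe.2 (Finset.mem_powerset.2 fun v hv => ?_)
            obtain ⟨hvr, hvK⟩ := Finset.mem_inter.1 hv
            refine Finset.mem_filter.2 ⟨hvK, fun c hc => ?_⟩
            have hc' := Finset.mem_sdiff.1 (hrs ▸ hc)
            exact hGH (hF r hrF hvr hc'.1 fun e => hc'.2 (e ▸ hvK))
          · intro r hr r' hr' heq
            have h1 := (Finset.mem_filter.1 hr).2.trans (Finset.mem_filter.1 hr').2.symm
            rw [← Finset.sdiff_union_inter r K, ← Finset.sdiff_union_inter r' K, h1]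
            exact congrArg _ heq
      _ = 2 ^ N.card := Finset.card_powerset _
      _ ≤ 2 ^ (k - (s \ K).card) := Nat.pow_le_pow_right two_pos hNcard
  calc F.card = ∑ C ∈ Kᶜ.powerset, (F.filter fun s => s \ K = C).card :=
        Finset.card_eq_sum_card_fiberwise fun s _ => by simp
    _ ≤ ∑ C ∈ Kᶜ.powerset, 1 ^ C.card * 2 ^ (k - C.card) := Finset.sum_le_sum hfiber
    _ = 3 ^ k := by
      have := Finset.sum_pow_mul_eq_add_pow (1 : ℕ) 2 Kᶜ
      rw [hcard] at this
      exact this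

/-! ### The upper bound for 2-CNF formulas -/

theorem CNF_eval_eq_true_iff {V : Type*} (φ : CNF V) (a : V → Bool) :
    φ.eval a = true ↔ ∀ c ∈ φ.clauses, ∃ l ∈ c, a l.1 = l.2 := by
  rw [CNF.eval, Array.all_eq_true_iff_forall_mem]
  simp [CNF.Clause.eval]

/-- The satisfying assignments of a 2-CNF formula are closed under majority. -/
theorem IsKCNF.majClosed {V : Type*} [DecidableEq V] {φ : CNF V} (hφ : IsKCNF 2 φ) :
    MajClosed {a | φ.eval a = true} := by
  have key : ∀ a : V → Bool, φ.eval a = true ↔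
      ∀ c ∈ φ.clauses, ∃ l ∈ c.toFinset, a l.1 = l.2 := by
    intro a
    simp only [CNF_eval_eq_true_iff, List.mem_toFinset]
  intro p hp q hq r hr
  rw [Set.mem_ofPred_eq, key] at *
  intro c hc
  obtain ⟨l, hl, hpl⟩ := hp c hc
  obtain ⟨m, hm, hqm⟩ := hq c hc
  obtain ⟨n, hn, hrn⟩ := hr c hc
  -- With at most two literals in the clause, two of the three assignments satisfy the same one.
  have hlmn : l = m ∨ m = n ∨ l = n := by
    by_contra hne
    push Not at hne
    exact absurd (Finset.two_lt_card_iff.2 ⟨l, m, n, hl, hm, hn, hne.1, hne.2.2, hne.2.1⟩)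
      (not_lt.2 (hφ c hc))
  rcases hlmn with rfl | rfl | rfl
  · refine ⟨l, hl, ?_⟩
    rw [hpl, hqm]
    cases l.2 <;> simp
  · refine ⟨m, hm, ?_⟩
    rw [hqm, hrn]
    cases m.2 <;> simp
  · refine ⟨l, hl, ?_⟩
    rw [hpl, hrn]
    cases l.2 <;> simp

/-- An affine set of assignments on which the inner product is constantly `0` shatters only
sets of at most `k` variables. -/
theorem card_le_of_affine_shattersOn {k : ℕ} {T : Set (IPVar k → Bool)} {I : Finset (IPVar k)}
    (hT : ∀ a ∈ T, ∀ b ∈ T, ∀ c ∈ T, (fun v => (a v ^^ b v ^^ c v)) ∈ T)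
    (hip : ∀ a ∈ T, innerProd a = true) (hI : ShattersOn T I) : I.card ≤ k := by
  obtain ⟨o, ho, -⟩ := hI fun _ => false
  let f : (IPVar k → Bool) → (IPVar k → ZMod 2) := fun a v => ((a v).toNat : ZMod 2)
  have hf : ∀ a b c : IPVar k → Bool, f (fun v => (a v ^^ b v ^^ c v)) = f a + f b + f c := by
    intro a b c
    ext v
    simp only [f, Pi.add_apply]
    cases a v <;> cases b v <;> cases c v <;> rfl
  have h2 : ∀ v : IPVar k → ZMod 2, v + v = 0 := fun v => by
    ext i; exact CharTwo.add_self_eq_zero _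
  let W : Submodule (ZMod 2) (IPVar k → ZMod 2) :=
    { carrier := {v | ∃ a ∈ T, f a = f o + v}
      zero_mem' := ⟨o, ho, by simp⟩
      add_mem' := by
        rintro v w ⟨a, ha, hav⟩ ⟨b, hb, hbw⟩
        refine ⟨_, hT a ha b hb o ho, ?_⟩
        rw [hf, hav, hbw]
        calc f o + v + (f o + w) + f o = f o + (v + w) + (f o + f o) := by abel
          _ = f o + (v + w) := by rw [h2, add_zero]
      smul_mem' := by
        intro c v hv
        have hc : c = 0 ∨ c = 1 := by revert c; decide
        rcases hc with rfl | rfl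
        · exact ⟨o, ho, by simp⟩
        · simpa using hv }
  have hW : Module.finrank (ZMod 2) W ≤ k := by
    refine finrank_le_of_ip_vanish W (f o) ?_
    rintro w ⟨a, ha, haw⟩
    rw [← haw]
    exact (innerProd_eq_true_iff a).1 (hip a ha)
  let r : W →ₗ[ZMod 2] (I → ZMod 2) :=
    (LinearMap.funLeft (ZMod 2) (ZMod 2) Subtype.val) ∘ₗ W.subtype
  have hr : Function.Surjective r := by
    intro u
    -- On `I` the target is `o + u`, so the direction `f o + f a` restricts to `u`.
    obtain ⟨a, ha, hau⟩ := hI fun v => if h : v ∈ I then (o v ^^ decide (u ⟨v, h⟩ = 1)) else false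
    refine ⟨⟨f o + f a, a, ha, by rw [← add_assoc, h2, zero_add]⟩, ?_⟩
    ext i
    change f o i + f a i = u i
    have hai := hau i i.2
    simp only [i.2, dif_pos] at hai
    simp only [f, hai]
    generalize u i = x
    cases o i <;> revert x <;> decide
  have h3 := LinearMap.finrank_le_finrank_of_surjective hr
  rw [Module.finrank_fintype_fun_eq_card, Fintype.card_coe] at h3
  exact h3.trans hW

theorem MajClosed.card_le_of_innerProd {k : ℕ} {S : Set (IPVar k → Bool)} (hS : MajClosed S)
    (hip : ∀ a ∈ S, innerProd a = true) {I : Finset (IPVar k)} (hI : ShattersOn S I) :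
    I.card ≤ k := by
  obtain ⟨T, hTS, hTI, hT⟩ := hS.exists_affine_subset hI
  exact card_le_of_affine_shattersOn hT (fun a ha => hip a (hTS ha)) hTI

/-- A finite set of assignments has at most as many elements as it shatters sets. -/
theorem exists_shattersOn_family {V : Type*} [Fintype V] [DecidableEq V]
    (S : Finset (V → Bool)) :
    ∃ F : Finset (Finset V), S.card ≤ F.card ∧ ∀ I ∈ F, ShattersOn (S : Set (V → Bool)) I := by
  let g : (V → Bool) → Finset V := fun a => Finset.univ.filter fun v => a v = true
  have hg : Function.Injective g := by
    intro a b hab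
    ext v
    have := Finset.ext_iff.1 hab v
    simp only [g, Finset.mem_filter, Finset.mem_univ, true_and] at this
    exact Bool.eq_iff_iff.2 this
  refine ⟨(S.image g).shatterer, ?_, fun I hI t => ?_⟩
  · rw [← Finset.card_image_of_injective S hg]
    exact Finset.card_le_card_shatterer _
  · obtain ⟨u, hu, hut⟩ := Finset.mem_shatterer.1 hI (Finset.filter_subset (fun v => t v = true) I)
    obtain ⟨s, hs, rfl⟩ := Finset.mem_image.1 hu
    refine ⟨s, hs, fun i hi => Bool.eq_iff_iff.2 ?_⟩
    have := Finset.ext_iff.1 hut i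
    simpa [g, hi] using this

theorem MajClosed.card_le_three_pow {k : ℕ} {S : Finset (IPVar k → Bool)}
    (hS : MajClosed (S : Set (IPVar k → Bool))) (hip : ∀ a ∈ S, innerProd a = true) :
    S.card ≤ 3 ^ k := by
  rcases S.eq_empty_or_nonempty with rfl | hne
  · simp
  -- A single vertex is a clique even if not shattered; for `k > 0` a `(k + 1)`-clique has an edge
  -- at each vertex.
  rcases Nat.eq_zero_or_pos k with rfl | hk
  · exact Finset.card_le_one.2 fun a _ b _ => funext fun v => by
      rcases v with v | v <;> exact v.elim0
  obtain ⟨F, hSF, hF⟩ := exists_shattersOn_family S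
  let G : SimpleGraph (IPVar k) :=
    { Adj := fun i j => i ≠ j ∧ ∀ t : IPVar k → Bool, ∃ s ∈ S, s i = t i ∧ s j = t j
      symm := ⟨fun i j h => ⟨h.1.symm, fun t => by
        obtain ⟨s, hs, h1, h2⟩ := h.2 t
        exact ⟨s, hs, h2, h1⟩⟩⟩
      loopless := ⟨fun i h => h.1 rfl⟩ }
  have hG : G.CliqueFree (k + 1) := by
    intro I hI
    have hsh : ShattersOn (S : Set (IPVar k → Bool)) I := by
      intro t
      refine hS.exists_agree hne t I fun i hi j hj => ?_
      by_cases hij : i = j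
      · subst hij
        obtain ⟨l, hl, hli⟩ := Finset.exists_mem_ne (s := I) (by rw [hI.2]; omega) i
        obtain ⟨s, hs, h1, -⟩ := (hI.1 hi hl hli.symm).2 t
        exact ⟨s, hs, h1, h1⟩
      · exact (hI.1 hi hj hij).2 t
    have := hS.card_le_of_innerProd hip hsh
    rw [hI.2] at this
    omega
  refine hSF.trans (hG.card_cliques_le (by simp; ring) F fun I hI i hi j hj hij =>
    ⟨hij, fun t => ?_⟩)
  obtain ⟨s, hs, hst⟩ := hF I hI t
  exact ⟨s, hs, hst i hi, hst j hj⟩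

/-! ### Tightness -/

/-- The 2-CNF formula with the clauses `¬ x i ∨ ¬ y i`. -/
def disjointnessCNF (k : ℕ) : CNF (IPVar k) where
  clauses := Array.ofFn fun i : Fin k => [(Sum.inl i, false), (Sum.inr i, false)]

theorem disjointnessCNF_eval {k : ℕ} (a : IPVar k → Bool) :
    (disjointnessCNF k).eval a = true ↔
      ∀ i, (a (Sum.inl i) && a (Sum.inr i)) = false := by
  simp only [CNF_eval_eq_true_iff, disjointnessCNF, Array.mem_ofFn, forall_exists_index,
    forall_apply_eq_imp_iff]
  simp [imp_iff_not_or]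

theorem card_satSet_disjointnessCNF (k : ℕ) : (satSet (disjointnessCNF k)).card = 3 ^ k := by
  have h : (Fintype.piFinset fun _ : Fin k =>
      Finset.univ.filter fun p : Bool × Bool => (p.1 && p.2) = false).card = 3 ^ k := by
    rw [Fintype.card_piFinset_const]
    rfl
  rw [← h]
  refine Finset.card_bij' (fun a _ i => (a (Sum.inl i), a (Sum.inr i)))
    (fun p _ => Sum.elim (fun i => (p i).1) fun i => (p i).2) ?_ ?_ ?_ ?_
  · intro a ha
    simpa [satSet, disjointnessCNF_eval] using ha
  · intro p hp
    simpa [satSet, disjointnessCNF_eval] using hp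
  · intro a _
    ext v
    rcases v with v | v <;> rfl
  · intro p _
    rfl

theorem mainTheorem11 (k : ℕ) :
    (∀ φ : CNF (IPVar k), IsKCNF 2 φ → ConsistentWithIP φ → (satSet φ).card ≤ 3 ^ k) ∧
    (∃ φ : CNF (IPVar k), IsKCNF 2 φ ∧ ConsistentWithIP φ ∧ (satSet φ).card = 3 ^ k) := by
  refine ⟨fun φ hφ hc => MajClosed.card_le_three_pow ?_ hc,
    disjointnessCNF k, ?_, ?_, card_satSet_disjointnessCNF k⟩
  · simpa [satSet] using hφ.majClosed
  · intro c hc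
    obtain ⟨i, rfl⟩ := Array.mem_ofFn.1 hc
    exact (List.toFinset_card_le _).trans (by simp)
  · intro a ha
    have h := (disjointnessCNF_eval a).1 (Finset.mem_filter.1 ha).2
    rw [innerProd_eq_true_iff]
    refine Finset.sum_eq_zero fun i _ => ?_
    have := h i
    cases h1 : a (Sum.inl i) <;> cases h2 : a (Sum.inr i) <;> simp_all
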